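/- Let $n\ge 2$ and $-1\le \ell<s<1$. Let $\mathcal A(n;[\ell,s])$ be the maximum cardinality of a nonempty finite set $C\subset\mathbb S^{n-1}\subset\mathbb R^n$ with $\ell\le\langle x,y\rangle\le s$ for all distinct $x,y\in C$. Let $d\mu(t)=\gamma_n(1-t^2)^{(n-3)/2}\,dt$ on $[-1,1]$, with $\gamma_n=\Gamma(\tfrac n2)/(\sqrt\pi\,\Gamma(\tfrac{n-1}2))$. Let $P_j^{1,0}$, $P_j^{1,\ell}$, $P_j^{1,\ell,s}$ be the polynomials of degree $j$ with value $1$ at $t=1$ that are orthogonal with respect to $(1-t)\,d\mu(t)$, $(t-\ell)(1-t)\,d\mu(t)$ and $(t-\ell)(s-t)(1-t)\,d\mu(t)$, respectively. Put $f_4(t)=(t-\ell)(t-s)\bigl(P_1^{1,\ell,s}(t)\bigr)^2$, $f_0=\int_{-1}^1 f_4\,d\mu$, and $$\alpha=-\frac{3+(n+2)(\ell s+\ell+s)}{(n+2)(n\ell s+\ell+s+1)} .$$ Assume that either (i) $\ell<t_{2,1}^{1,0}$ and $t_{2,2}^{1,0}<s<t_{2,2}^{1,\ell}$, where $t_{2,1}^{1,0}<t_{2,2}^{1,0}$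 are the zeros of $P_2^{1,0}$ and $t_{2,2}^{1,\ell}$ is the largest zero of $P_2^{1,\ell}$ (if the orthogonal polynomial of degree $2$ for $(t-\ell)(1-t)\,d\mu(t)$ vanishes at $t=1$, so that it cannot be normalized, the upper bound on $s$ is just $s<1$), or (ii) $n\ell s+\ell+s+1\ne0$ and $f_0>0$. Assume also $$\ell+s+2\alpha\le0,$$ $$\alpha^2+2(\ell+s)\alpha+\ell s+\frac6{n+4}\ge0,$$ $$(\ell+s)\alpha^2+2\alpha\Bigl(\ell s+\frac3{n+2}\Bigr)+\frac{3(\ell+s)}{n+2}\le0 .$$ Then $\alpha$ is the only zero of $P_1^{1,\ell,s}$, $f_0>0$, and $$\mathcal A(n;[\ell,s])\le\frac{f_4(1)}{f_0}=\frac{n(1-\ell)(1-s)\bigl[3+(n+2)(n\ell s+\ell s+2\ell+2s+1)\bigr]}{(n+2)\bigl[n\ell^2s^2-(\ell-s)^2\bigr]-6\ell s+3}.$$ -/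

import Mathlib

open Polynomial

noncomputable section

namespace SphericalCode

/-- `C` is a spherical code on the unit sphere of `ℝⁿ` all of whose inner products of distinct
points lie in `[ℓ, s]`. -/
def IsCode (n : ℕ) (ℓ s : ℝ) (C : Finset (EuclideanSpace ℝ (Fin n))) : Prop :=
  C.Nonempty ∧ (∀ x ∈ C, ‖x‖ = 1) ∧
    ∀ x ∈ C, ∀ y ∈ C, x ≠ y → ℓ ≤ inner ℝ x y ∧ inner ℝ x y ≤ s

/-- `𝒜(n; [ℓ, s])`, the largest cardinality of a code with inner products in `[ℓ, s]`
(a supremum in `ℕ∞`, so it is `⊤` if the cardinalities are unbounded). -/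
def maxCard (n : ℕ) (ℓ s : ℝ) : ℕ∞ :=
  ⨆ (C : Finset (EuclideanSpace ℝ (Fin n))) (_ : IsCode n ℓ s C), (C.card : ℕ∞)

/-- The normalizing constant `γₙ = Γ(n/2) / (√π Γ((n-1)/2))`. -/
def gammaConst (n : ℕ) : ℝ :=
  Real.Gamma ((n : ℝ) / 2) / (Real.sqrt Real.pi * Real.Gamma (((n : ℝ) - 1) / 2))

/-- `∫ p dμ` for the probability measure `dμ(t) = γₙ (1 - t²)^((n-3)/2) dt` on `[-1, 1]`; this is
the zeroth coefficient `p₀` in the Gegenbauer expansion of `p`. -/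
def zerothCoeff (n : ℕ) (p : ℝ[X]) : ℝ :=
  ∫ t in (-1 : ℝ)..1, p.eval t * (gammaConst n * (1 - t ^ 2) ^ (((n : ℝ) - 3) / 2))

/-- The monic orthogonal polynomials of the signed measure `w(t) dμ(t)`, by Gram-Schmidt
orthogonalization of the monomials. -/
def monicOrth (n : ℕ) (w : ℝ[X]) (k : ℕ) : ℝ[X] :=
  X ^ k - ∑ j : Fin k,
    C (zerothCoeff n (X ^ k * monicOrth n w j * w) /
        zerothCoeff n (monicOrth n w j * monicOrth n w j * w)) * monicOrth n w j
termination_by k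
decreasing_by exact j.2

/-- The orthogonal polynomial of degree `k` of the signed measure `w(t) dμ(t)`, normalized to have
the value `1` at `t = 1`. -/
def orthPoly (n : ℕ) (w : ℝ[X]) (k : ℕ) : ℝ[X] :=
  C ((monicOrth n w k).eval 1)⁻¹ * monicOrth n w k

/-- `P_k^{1,0}`: orthogonal with respect to `dχ(t) = (1 - t) dμ(t)`. -/
def P10 (n k : ℕ) : ℝ[X] := orthPoly n (1 - X) k

/-- `P_k^{1,ℓ}`: orthogonal with respect to `dν_ℓ(t) = (t - ℓ) dχ(t)`. -/
def P1l (n : ℕ) (ℓ : ℝ) (k : ℕ) : ℝ[X] := orthPoly n ((X - C ℓ) * (1 - X)) k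

/-- `P_k^{1,ℓ,s}`: orthogonal with respect to `dν_{ℓ,s}(t) = (t - ℓ)(s - t) dχ(t)`. -/
def P1ls (n : ℕ) (ℓ s : ℝ) (k : ℕ) : ℝ[X] :=
  orthPoly n ((X - C ℓ) * (C s - X) * (1 - X)) k

/-- The Levenshtein-type polynomial `f_{2k}(t) = (t - ℓ)(t - s) (P_{k-1}^{1,ℓ,s}(t))²`, `k ≥ 1`. -/
def levPoly (n k : ℕ) (ℓ s : ℝ) : ℝ[X] :=
  (X - C ℓ) * (X - C s) * P1ls n ℓ s (k - 1) ^ 2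

/-- `ℓ < t_{k,1}^{1,0}` and `t_{k,k}^{1,0} < s < t_{k,k}^{1,ℓ}`: `ℓ` lies below all the zeros of
`P_k^{1,0}`, `s` lies above all of them, and `s` is smaller than the largest zero of
`P_k^{1,ℓ}`. -/
def InRange (n k : ℕ) (ℓ s : ℝ) : Prop :=
  (∀ t, (P10 n k).IsRoot t → ℓ < t) ∧ (∀ t, (P10 n k).IsRoot t → t < s) ∧
    ∃ t, (P1l n ℓ k).IsRoot t ∧ s < t

end SphericalCode

end

/-!
The bound is Delsarte's linear programming bound for the quartic
`f(t) = (t - ℓ)(t - s)((t - α)/(1 - α))²`. This `f` is nonpositive on `[ℓ, s]`, and the three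
inequalities assumed of `ℓ, s, α` say exactly that its Gegenbauer coefficients of degrees `3`, `2`
and `1` are nonnegative. Summing `f(⟨x, y⟩)` over all pairs of points of a code `K` then gives
`|K|² f₀ ≤ |K| f(1)`: see `card_mul_le_of_gegenbauer`. The positive semidefiniteness of the
Gegenbauer kernels of degree at most `4` is proved by writing each of them as the inner product of
the traceless parts of the tensor powers of `x` and `y` (`sum_harm₂_mul`, `sum_harm₃_mul`,
`sum_harm₄_mul`).

The moments of `μ` of order at most `5` follow from the Beta integral and one integration by parts
(`zerothCoeff_of_eval_eq`). They give `P_1^{1,ℓ,s}(t) = (t - α)/(1 - α)`, where `α < 1` because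
`ℓ + s + 2α ≤ 0`. Orthogonality of `t - α` to the constants turns `f₀` into
`(1 - α)⁻¹ ∫ (t - ℓ)(t - s)(t - α) dμ`, which is `(1 - α)⁻¹ B / (n (n + 2) D)` with
`D = n ℓ s + ℓ + s + 1` and `B` the denominator of the asserted bound (`boundDenom`). This is the
closed form of `f(1) / f₀`.

It remains to show `f₀ > 0` under hypothesis (i). There `D < 0` (`weight_mass_pos`), and `B < 0` has
to be proved (`boundDenom_neg`). As a function of `s`, `B` is a strictly convex quadratic that is
negative at the left end `t_{2,2}^{1,0}`, so it is enough to find a point to the right of `s` where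
`B ≤ 0`. If `(n + 2) ℓ² ≥ 3`, a zero of `P_2^{1,ℓ}` beyond `s` is such a point. If
`(n + 2) ℓ² < 3`, the hypothesis `ℓ + s + 2α ≤ 0` forces `s < -ℓ`, and `-ℓ` is such a point. The
upper bound on `s` alone would not suffice in the second case, where the largest zero of `P_2^{1,ℓ}`
can exceed `1`.
-/

noncomputable section

namespace SphericalCode

/-! ### Moments of the measure `μ` -/

section Moments

open MeasureTheory Set

lemma intervalIntegrable_one_sub_sq_rpow {r : ℝ} (hr : -1 < r) :
    IntervalIntegrable (fun t : ℝ => (1 - t ^ 2) ^ r) volume (-1) 1 := by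
  have right : IntervalIntegrable (fun t : ℝ => (1 - t ^ 2) ^ r) volume 0 1 := by
    have h := ((intervalIntegral.intervalIntegrable_rpow' (a := 0) (b := 1) hr).comp_sub_left
      1).symm
    simp only [sub_self, sub_zero] at h
    have hc : ContinuousOn (fun t : ℝ => (1 + t) ^ r) (uIcc 0 1) := by
      rw [uIcc_of_le zero_le_one]
      refine ContinuousOn.rpow_const (by fun_prop) fun t ht => Or.inl ?_
      have := ht.1
      positivity
    refine (h.mul_continuousOn hc).congr fun t ht => ?_
    rw [uIoc_of_le zero_le_one] at ht
    rw [← Real.mul_rpow (by linarith [ht.2]) (by linarith [ht.1])]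
    congr 1
    ring
  have left : IntervalIntegrable (fun t : ℝ => (1 - t ^ 2) ^ r) volume (-1) 0 := by
    rw [IntervalIntegrable.iff_comp_neg]
    simpa using right.symm
  exact left.trans right

/-- The total mass of `(1 - t²)^(v - 1) dt`, by the substitution `t = 2u - 1` into the Beta
integral. -/
lemma integral_one_sub_sq_rpow {v : ℝ} (hv : 0 < v) :
    ∫ t in (-1 : ℝ)..1, (1 - t ^ 2) ^ (v - 1) =
      2 * 4 ^ (v - 1) * (Real.Gamma v * Real.Gamma v / Real.Gamma (2 * v)) := by
  have hbeta : ∫ u in (0 : ℝ)..1, u ^ (v - 1) * (1 - u) ^ (v - 1) =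
      Real.Gamma v * Real.Gamma v / Real.Gamma (2 * v) := by
    have h := ProbabilityTheory.beta_eq_betaIntegralReal v v hv hv
    rw [ProbabilityTheory.beta, ← two_mul] at h
    rw [h, Complex.betaIntegral]
    have hcongr : ∫ x in (0 : ℝ)..1, (x : ℂ) ^ ((v : ℂ) - 1) * (1 - (x : ℂ)) ^ ((v : ℂ) - 1) =
        ∫ x in (0 : ℝ)..1, ((x ^ (v - 1) * (1 - x) ^ (v - 1) : ℝ) : ℂ) := by
      refine intervalIntegral.integral_congr fun x hx => ?_
      rw [uIcc_of_le zero_le_one] at hx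
      push_cast
      rw [Complex.ofReal_cpow hx.1, Complex.ofReal_cpow (by linarith [hx.2])]
      push_cast
      rfl
    rw [hcongr, intervalIntegral.integral_ofReal, Complex.ofReal_re]
  have hsub := intervalIntegral.integral_comp_mul_sub (a := 0) (b := 1)
    (fun t : ℝ => (1 - t ^ 2) ^ (v - 1)) (two_ne_zero) 1
  have hcongr : ∫ u in (0 : ℝ)..1, (1 - (2 * u - 1) ^ 2) ^ (v - 1) =
      ∫ u in (0 : ℝ)..1, 4 ^ (v - 1) * (u ^ (v - 1) * (1 - u) ^ (v - 1)) := by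
    refine intervalIntegral.integral_congr fun u hu => ?_
    rw [uIcc_of_le zero_le_one] at hu
    rw [← Real.mul_rpow hu.1 (by linarith [hu.2]),
      ← Real.mul_rpow (by norm_num) (mul_nonneg hu.1 (by linarith [hu.2]))]
    congr 1
    ring
  rw [hcongr, intervalIntegral.integral_const_mul, hbeta] at hsub
  norm_num at hsub
  linarith

/-- `γₙ` normalizes `μ` to a probability measure; this is Legendre's duplication formula. -/
lemma gammaConst_mul_integral (n : ℕ) (hn : 2 ≤ n) :
    gammaConst n * ∫ t in (-1 : ℝ)..1, (1 - t ^ 2) ^ (((n : ℝ) - 3) / 2) = 1 := by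
  have hn' : (2 : ℝ) ≤ n := by exact_mod_cast hn
  set v : ℝ := ((n : ℝ) - 1) / 2 with hv
  have hv0 : 0 < v := by rw [hv]; linarith
  have e1 : ((n : ℝ) - 3) / 2 = v - 1 := by rw [hv]; ring
  have e2 : (n : ℝ) / 2 = v + 1 / 2 := by rw [hv]; ring
  rw [e1, integral_one_sub_sq_rpow hv0, gammaConst, ← hv, e2]
  have hd := Real.Gamma_mul_Gamma_add_half v
  have g1 := Real.Gamma_pos_of_pos hv0
  have g2 := Real.Gamma_pos_of_pos (show 0 < 2 * v by linarith)
  have hpi : 0 < Real.sqrt Real.pi := Real.sqrt_pos.2 Real.pi_pos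
  have hpow : (2 : ℝ) ^ (1 - 2 * v) * (2 * 4 ^ (v - 1)) = 1 := by
    have h4 : (4 : ℝ) ^ (v - 1) = 2 ^ (2 * (v - 1)) := by
      rw [Real.rpow_mul (by norm_num)]
      norm_num
    have h2 : (2 : ℝ) * 2 ^ (2 * (v - 1)) = 2 ^ (1 + 2 * (v - 1)) := by
      rw [Real.rpow_add (by norm_num), Real.rpow_one]
    rw [h4, h2, ← Real.rpow_add (by norm_num)]
    ring_nf
    simp
  calc _ = (Real.Gamma v * Real.Gamma (v + 1 / 2)) * (2 * 4 ^ (v - 1)) /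
        (Real.sqrt Real.pi * Real.Gamma (2 * v)) := by field_simp
    _ = ((2 : ℝ) ^ (1 - 2 * v) * (2 * 4 ^ (v - 1))) := by rw [hd]; field_simp
    _ = 1 := hpow

/-- The `k`-th moment of `μ`. -/
def moment (n k : ℕ) : ℝ :=
  ∫ t in (-1 : ℝ)..1, t ^ k * (gammaConst n * (1 - t ^ 2) ^ (((n : ℝ) - 3) / 2))

lemma intervalIntegrable_pow_mul_weight (n k : ℕ) (hn : 2 ≤ n) :
    IntervalIntegrable
      (fun t : ℝ => t ^ k * (gammaConst n * (1 - t ^ 2) ^ (((n : ℝ) - 3) / 2)))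
      volume (-1) 1 := by
  have hn' : (2 : ℝ) ≤ n := by exact_mod_cast hn
  exact ((intervalIntegrable_one_sub_sq_rpow (by linarith)).const_mul _).continuousOn_mul
    (by fun_prop)

lemma moment_zero (n : ℕ) (hn : 2 ≤ n) : moment n 0 = 1 := by
  simp only [moment, pow_zero, one_mul]
  rw [intervalIntegral.integral_const_mul, gammaConst_mul_integral n hn]

/-- Integration by parts: the derivative of `t^k (1 - t²)^((n-1)/2)` integrates to `0`. -/
lemma add_mul_moment_succ (n k : ℕ) (hn : 2 ≤ n) :
    ((k : ℝ) + n - 1) * moment n (k + 1) = k * moment n (k - 1) := by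
  have hn' : (2 : ℝ) ≤ n := by exact_mod_cast hn
  set r : ℝ := ((n : ℝ) - 3) / 2 with hr
  set c := gammaConst n
  have key := intervalIntegral.integral_eq_sub_of_hasDerivAt_of_le (a := -1) (b := 1)
    (f := fun t : ℝ => c * (t ^ k * (1 - t ^ 2) ^ (r + 1)))
    (f' := fun t : ℝ => k * (t ^ (k - 1) * (c * (1 - t ^ 2) ^ r)) -
      ((k : ℝ) + n - 1) * (t ^ (k + 1) * (c * (1 - t ^ 2) ^ r)))
    (by norm_num) ?_ ?_ ?_
  · rw [intervalIntegral.integral_sub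
      ((intervalIntegrable_pow_mul_weight n (k - 1) hn).const_mul _)
      ((intervalIntegrable_pow_mul_weight n (k + 1) hn).const_mul _),
      intervalIntegral.integral_const_mul, intervalIntegral.integral_const_mul] at key
    have hr1 : r + 1 ≠ 0 := by rw [hr]; linarith
    norm_num [Real.zero_rpow hr1] at key
    unfold moment
    linarith
  · have hr1 : 0 ≤ r + 1 := by rw [hr]; linarith
    exact continuousOn_const.mul ((continuousOn_pow k).mul
      (ContinuousOn.rpow_const (by fun_prop) fun t _ => Or.inr hr1))
  · intro t ht
    have hpos : 0 < 1 - t ^ 2 := by nlinarith [ht.1, ht.2]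
    have hbase : HasDerivAt (fun t : ℝ => 1 - t ^ 2) (-(2 * t)) t := by
      simpa using (hasDerivAt_pow 2 t).const_sub 1
    have h := (((hasDerivAt_pow k t).mul
      (hbase.rpow_const (p := r + 1) (Or.inl hpos.ne'))).const_mul c)
    refine h.congr_deriv ?_
    simp only [add_sub_cancel_right]
    rw [Real.rpow_add hpos, Real.rpow_one]
    have hk : (k : ℝ) * t ^ (k + 1) = k * (t ^ (k - 1) * t ^ 2) := by
      rcases k with _ | k
      · simp
      · rw [← pow_add]; rfl
    have hnr : (n : ℝ) = 2 * r + 3 := by rw [hr]; ring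
    rw [hnr]
    linear_combination (c * (1 - t ^ 2) ^ r) * hk
  · exact ((intervalIntegrable_pow_mul_weight n (k - 1) hn).const_mul _).sub
      ((intervalIntegrable_pow_mul_weight n (k + 1) hn).const_mul _)

/-- `∫ p dμ` for a polynomial `p` of degree at most `5`. -/
lemma zerothCoeff_of_eval_eq (n : ℕ) (hn : 2 ≤ n) (p : ℝ[X]) (c₀ c₁ c₂ c₃ c₄ c₅ : ℝ)
    (hp : ∀ t, p.eval t = c₀ + c₁ * t + c₂ * t ^ 2 + c₃ * t ^ 3 + c₄ * t ^ 4 + c₅ * t ^ 5) :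
    zerothCoeff n p = c₀ + c₂ / n + 3 * c₄ / (n * (n + 2)) := by
  have hn' : (2 : ℝ) ≤ n := by exact_mod_cast hn
  have hn0 : (n : ℝ) ≠ 0 := by positivity
  have m0 := moment_zero n hn
  have m1 : moment n 1 = 0 := by
    have h := add_mul_moment_succ n 0 hn
    simp only [Nat.cast_zero, zero_mul, zero_add, mul_eq_zero] at h
    rcases h with h | h
    · linarith
    · exact h
  have m2 : moment n 2 = 1 / n := by
    have h := add_mul_moment_succ n 1 hn
    simp [m0] at h
    field_simp
    linarith
  have m3 : moment n 3 = 0 := by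
    have h := add_mul_moment_succ n 2 hn
    simp [m1] at h
    rcases h with h | h
    · linarith
    · exact h
  have m4 : moment n 4 = 3 / (n * (n + 2)) := by
    have h := add_mul_moment_succ n 3 hn
    norm_num [m2] at h
    field_simp at h ⊢
    linarith
  have m5 : moment n 5 = 0 := by
    have h := add_mul_moment_succ n 4 hn
    simp [m3] at h
    rcases h with h | h
    · linarith
    · exact h
  have hI := fun k => intervalIntegrable_pow_mul_weight n k hn
  have hsum : zerothCoeff n p = c₀ * moment n 0 + c₁ * moment n 1 + c₂ * moment n 2 +
      c₃ * moment n 3 + c₄ * moment n 4 + c₅ * moment n 5 := by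
    simp only [moment, ← intervalIntegral.integral_const_mul]
    rw [← intervalIntegral.integral_add ((hI 0).const_mul _) ((hI 1).const_mul _),
      ← intervalIntegral.integral_add (((hI 0).const_mul _).add ((hI 1).const_mul _))
        ((hI 2).const_mul _),
      ← intervalIntegral.integral_add ((((hI 0).const_mul _).add ((hI 1).const_mul _)).add
        ((hI 2).const_mul _)) ((hI 3).const_mul _),
      ← intervalIntegral.integral_add (((((hI 0).const_mul _).add ((hI 1).const_mul _)).add
        ((hI 2).const_mul _)).add ((hI 3).const_mul _)) ((hI 4).const_mul _),
      ← intervalIntegral.integral_add ((((((hI 0).const_mul _).add ((hI 1).const_mul _)).add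
        ((hI 2).const_mul _)).add ((hI 3).const_mul _)).add ((hI 4).const_mul _))
        ((hI 5).const_mul _)]
    refine intervalIntegral.integral_congr fun t _ => ?_
    simp only [hp]
    ring
  rw [hsum, m0, m1, m2, m3, m4, m5]
  ring

end Moments

/-! ### Gegenbauer kernels as inner products of traceless tensors -/

section Tensors

/-- The Kronecker delta. -/
def kron {ι : Type*} [DecidableEq ι] (i j : ι) : ℝ := if i = j then 1 else 0

lemma kron_comm {ι : Type*} [DecidableEq ι] (i j : ι) : kron i j = kron j i := by
  simp only [kron, eq_comm]

lemma kron_self {ι : Type*} [DecidableEq ι] (i : ι) : kron i i = 1 := by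
  simp [kron]

lemma sum_mul_kron {ι : Type*} [Fintype ι] [DecidableEq ι] (f : ι → ℝ) (k : ι) :
    ∑ l, f l * kron k l = f k := by
  simp [kron]

/-- The traceless part of `x ⊗ x` for a unit vector `x` of `ℝⁿ`. -/
def harm₂ (n : ℕ) (x : Fin n → ℝ) (i j : Fin n) : ℝ :=
  x i * x j - 1 / n * kron i j

/-- The traceless part of `x ⊗ x ⊗ x` for a unit vector `x` of `ℝⁿ`. -/
def harm₃ (n : ℕ) (x : Fin n → ℝ) (i j k : Fin n) : ℝ :=
  x i * x j * x k - 1 / ((n : ℝ) + 2) * (x i * kron j k + x j * kron i k + x k * kron i j)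

/-- The traceless part of `x ⊗ x ⊗ x ⊗ x` for a unit vector `x` of `ℝⁿ`. -/
def harm₄ (n : ℕ) (x : Fin n → ℝ) (i j k l : Fin n) : ℝ :=
  x i * x j * x k * x l
    - 1 / ((n : ℝ) + 4) * (x i * x j * kron k l + x i * x k * kron j l + x i * x l * kron j k
      + x j * x k * kron i l + x j * x l * kron i k + x k * x l * kron i j)
    + 1 / (((n : ℝ) + 2) * (n + 4)) *
      (kron i j * kron k l + kron i k * kron j l + kron i l * kron j k)

variable {n : ℕ}

lemma trace_harm₂ (hn : n ≠ 0) {x : Fin n → ℝ} (hx : ∑ i, x i * x i = 1) :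
    ∑ i, harm₂ n x i i = 0 := by
  have hn' : (n : ℝ) ≠ 0 := by exact_mod_cast hn
  simp [harm₂, Finset.sum_sub_distrib, hx, kron_self, hn']

lemma trace_harm₃ {x : Fin n → ℝ} (hx : ∑ i, x i * x i = 1) (i : Fin n) :
    ∑ m, harm₃ n x i m m = 0 := by
  have hn' : (n : ℝ) + 2 ≠ 0 := by positivity
  have h : ∀ m, harm₃ n x i m m = x i * (x m * x m) - 1 / ((n : ℝ) + 2) * x i
      - 2 / ((n : ℝ) + 2) * (x m * kron i m) := by
    intro m
    simp only [harm₃, kron_self]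
    ring
  simp only [h, Finset.sum_sub_distrib, ← Finset.mul_sum, sum_mul_kron, hx, Finset.sum_const,
    Finset.card_univ, Fintype.card_fin, nsmul_eq_mul]
  field_simp
  ring

lemma trace_harm₄ {x : Fin n → ℝ} (hx : ∑ i, x i * x i = 1) (i j : Fin n) :
    ∑ m, harm₄ n x i j m m = 0 := by
  have hn2 : (n : ℝ) + 2 ≠ 0 := by positivity
  have hn4 : (n : ℝ) + 4 ≠ 0 := by positivity
  have h : ∀ m, harm₄ n x i j m m = (x i * x j - 1 / ((n : ℝ) + 4) * kron i j) * (x m * x m)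
      + (1 / (((n : ℝ) + 2) * (n + 4)) * kron i j - 1 / ((n : ℝ) + 4) * (x i * x j))
      - (2 / ((n : ℝ) + 4) * x i) * (x m * kron j m)
      - (2 / ((n : ℝ) + 4) * x j) * (x m * kron i m)
      + 2 / (((n : ℝ) + 2) * (n + 4)) * (kron i m * kron j m) := by
    intro m
    simp only [harm₄, kron_self]
    ring
  simp only [h, Finset.sum_sub_distrib, Finset.sum_add_distrib, ← Finset.mul_sum, sum_mul_kron,
    hx, Finset.sum_const, Finset.card_univ, Fintype.card_fin, nsmul_eq_mul]
  field_simp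
  ring


lemma harm₄_swap₁₂ (x : Fin n → ℝ) (i j k l : Fin n) :
    harm₄ n x j i k l = harm₄ n x i j k l := by
  simp only [harm₄, kron_comm j i]
  ring

lemma harm₄_swap₂₃ (x : Fin n → ℝ) (i j k l : Fin n) :
    harm₄ n x i k j l = harm₄ n x i j k l := by
  simp only [harm₄, kron_comm k j]
  ring

lemma harm₄_swap₃₄ (x : Fin n → ℝ) (i j k l : Fin n) :
    harm₄ n x i j l k = harm₄ n x i j k l := by
  simp only [harm₄, kron_comm l k]
  ring

/-- The kernel `⟨x, y⟩² - 1/n` as an inner product of traceless tensors. -/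
lemma sum_harm₂_mul (hn : n ≠ 0) {x y : Fin n → ℝ} {t : ℝ} (hx : ∑ i, x i * x i = 1)
    (hy : ∑ i, y i * y i = 1) (hxy : ∑ i, x i * y i = t) :
    ∑ i, ∑ j, harm₂ n x i j * harm₂ n y i j = t ^ 2 - 1 / n := by
  have c₁ : ∀ i, ∑ j, x j * harm₂ n y i j = t * y i - 1 / n * x i := by
    intro i
    have h : ∀ j, x j * harm₂ n y i j = y i * (x j * y j) - 1 / n * (x j * kron i j) := by
      intro j
      simp only [harm₂]
      ring
    simp only [h, Finset.sum_sub_distrib, ← Finset.mul_sum, sum_mul_kron, hxy]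
    ring
  have h : ∀ i j, harm₂ n x i j * harm₂ n y i j =
      x i * (x j * harm₂ n y i j) - 1 / n * (harm₂ n y i j * kron i j) := by
    intro i j
    rw [harm₂]
    ring
  have h' : ∀ i, x i * (t * y i - 1 / n * x i) = t * (x i * y i) - 1 / n * (x i * x i) := by
    intro i
    ring
  simp only [h, Finset.sum_sub_distrib, ← Finset.mul_sum, sum_mul_kron, trace_harm₂ hn hy, c₁, h',
    hxy, hx]
  ring

/-- The kernel `⟨x, y⟩³ - 3/(n+2) ⟨x, y⟩` as an inner product of traceless tensors. -/
lemma sum_harm₃_mul {x y : Fin n → ℝ} {t : ℝ} (hx : ∑ i, x i * x i = 1)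
    (hy : ∑ i, y i * y i = 1) (hxy : ∑ i, x i * y i = t) :
    ∑ i, ∑ j, ∑ k, harm₃ n x i j k * harm₃ n y i j k = t ^ 3 - 3 / ((n : ℝ) + 2) * t := by
  set a : ℝ := 1 / ((n : ℝ) + 2) with ha
  have c₁ : ∀ i j, ∑ k, x k * harm₃ n y i j k =
      t * (y i * y j) - a * (y i * x j + y j * x i + t * kron i j) := by
    intro i j
    have h : ∀ k, x k * harm₃ n y i j k = (y i * y j - a * kron i j) * (x k * y k)
        - a * y i * (x k * kron j k) - a * y j * (x k * kron i k) := by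
      intro k
      simp only [harm₃]
      ring
    simp only [h, Finset.sum_sub_distrib, ← Finset.mul_sum, sum_mul_kron, hxy]
    ring
  have c₂ : ∀ i, ∑ j, x j * (t * (y i * y j) - a * (y i * x j + y j * x i + t * kron i j)) =
      t ^ 2 * y i - a * (y i + 2 * t * x i) := by
    intro i
    have h : ∀ j, x j * (t * (y i * y j) - a * (y i * x j + y j * x i + t * kron i j)) =
        (t * y i - a * x i) * (x j * y j) - a * y i * (x j * x j) - a * t * (x j * kron i j) := by
      intro j
      ring
    simp only [h, Finset.sum_sub_distrib, ← Finset.mul_sum, sum_mul_kron, hxy, hx]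
    ring
  have c₃ : ∑ i, x i * (t ^ 2 * y i - a * (y i + 2 * t * x i)) = t ^ 3 - 3 * a * t := by
    have h : ∀ i, x i * (t ^ 2 * y i - a * (y i + 2 * t * x i)) =
        (t ^ 2 - a) * (x i * y i) - 2 * a * t * (x i * x i) := by
      intro i
      ring
    simp only [h, Finset.sum_sub_distrib, ← Finset.mul_sum, hxy, hx]
    ring
  have z₂₃ : ∑ i, ∑ j, ∑ k, x i * (harm₃ n y i j k * kron j k) = 0 := by
    simp only [← Finset.mul_sum, sum_mul_kron, trace_harm₃ hy, mul_zero, Finset.sum_const_zero]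
  have z₁₃ : ∑ i, ∑ j, ∑ k, x j * (harm₃ n y i j k * kron i k) = 0 := by
    rw [Finset.sum_comm, ← z₂₃]
    refine Finset.sum_congr rfl fun i _ => Finset.sum_congr rfl fun j _ =>
      Finset.sum_congr rfl fun k _ => ?_
    simp only [harm₃, kron_comm j i]
    ring
  have z₁₂ : ∑ i, ∑ j, ∑ k, x k * (harm₃ n y i j k * kron i j) = 0 := by
    rw [Finset.sum_congr rfl fun i _ => Finset.sum_comm, ← z₁₃]
    refine Finset.sum_congr rfl fun i _ => Finset.sum_congr rfl fun j _ =>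
      Finset.sum_congr rfl fun k _ => ?_
    simp only [harm₃, kron_comm k j]
    ring
  have h : ∀ i j k, harm₃ n x i j k * harm₃ n y i j k = x i * (x j * (x k * harm₃ n y i j k))
      - a * (x i * (harm₃ n y i j k * kron j k)) - a * (x j * (harm₃ n y i j k * kron i k))
      - a * (x k * (harm₃ n y i j k * kron i j)) := by
    intro i j k
    rw [harm₃]
    ring
  simp only [h, Finset.sum_sub_distrib]
  have e : ∑ i, ∑ j, ∑ k, x i * (x j * (x k * harm₃ n y i j k)) = t ^ 3 - 3 * a * t := by
    simp only [← Finset.mul_sum, c₁, c₂, c₃]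
  simp only [← Finset.mul_sum] at z₁₂ z₁₃ z₂₃ e ⊢
  rw [e, z₁₂, z₁₃, z₂₃, ha]
  ring

/-- Contracting a traceless symmetric tensor with a tensor that has a Kronecker delta as a factor
gives `0`, whatever the two slots of the delta are. -/
lemma sum_harm₄_mul_kron {y : Fin n → ℝ} (hy : ∑ i, y i * y i = 1) (M : Fin n → Fin n → ℝ) :
    (∑ i, ∑ j, ∑ k, ∑ l, M i j * (harm₄ n y i j k l * kron k l) = 0) ∧
    (∑ i, ∑ j, ∑ k, ∑ l, M i k * (harm₄ n y i j k l * kron j l) = 0) ∧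
    (∑ i, ∑ j, ∑ k, ∑ l, M i l * (harm₄ n y i j k l * kron j k) = 0) ∧
    (∑ i, ∑ j, ∑ k, ∑ l, M j k * (harm₄ n y i j k l * kron i l) = 0) ∧
    (∑ i, ∑ j, ∑ k, ∑ l, M j l * (harm₄ n y i j k l * kron i k) = 0) ∧
    (∑ i, ∑ j, ∑ k, ∑ l, M k l * (harm₄ n y i j k l * kron i j) = 0) := by
  have z₃₄ : ∑ i, ∑ j, ∑ k, ∑ l, M i j * (harm₄ n y i j k l * kron k l) = 0 := by
    simp only [← Finset.mul_sum, sum_mul_kron, trace_harm₄ hy, mul_zero, Finset.sum_const_zero]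
  have z₂₄ : ∑ i, ∑ j, ∑ k, ∑ l, M i k * (harm₄ n y i j k l * kron j l) = 0 := by
    rw [Finset.sum_congr rfl fun i _ => Finset.sum_comm, ← z₃₄]
    simp only [harm₄_swap₂₃ y]
  have z₂₃ : ∑ i, ∑ j, ∑ k, ∑ l, M i l * (harm₄ n y i j k l * kron j k) = 0 := by
    rw [Finset.sum_congr rfl fun i _ => Finset.sum_congr rfl fun j _ => Finset.sum_comm, ← z₂₄]
    simp only [harm₄_swap₃₄ y]
  have z₁₄ : ∑ i, ∑ j, ∑ k, ∑ l, M j k * (harm₄ n y i j k l * kron i l) = 0 := by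
    rw [Finset.sum_comm, ← z₂₄]
    simp only [harm₄_swap₁₂ y]
  have z₁₃ : ∑ i, ∑ j, ∑ k, ∑ l, M j l * (harm₄ n y i j k l * kron i k) = 0 := by
    rw [Finset.sum_comm, ← z₂₃]
    simp only [harm₄_swap₁₂ y]
  have z₁₂ : ∑ i, ∑ j, ∑ k, ∑ l, M k l * (harm₄ n y i j k l * kron i j) = 0 := by
    rw [Finset.sum_congr rfl fun i _ => Finset.sum_comm, ← z₁₃]
    simp only [harm₄_swap₂₃ y]
  exact ⟨z₃₄, z₂₄, z₂₃, z₁₄, z₁₃, z₁₂⟩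

/-- The kernel `⟨x, y⟩⁴ - 6/(n+4) ⟨x, y⟩² + 3/((n+2)(n+4))` as an inner product of traceless
tensors. -/
lemma sum_harm₄_mul {x y : Fin n → ℝ} {t : ℝ} (hx : ∑ i, x i * x i = 1)
    (hy : ∑ i, y i * y i = 1) (hxy : ∑ i, x i * y i = t) :
    ∑ i, ∑ j, ∑ k, ∑ l, harm₄ n x i j k l * harm₄ n y i j k l =
      t ^ 4 - 6 / ((n : ℝ) + 4) * t ^ 2 + 3 / (((n : ℝ) + 2) * (n + 4)) := by
  set a : ℝ := 1 / ((n : ℝ) + 4) with ha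
  set b : ℝ := 1 / (((n : ℝ) + 2) * (n + 4)) with hb
  have c₁ : ∀ i j k, ∑ l, x l * harm₄ n y i j k l =
      t * (y i * y j * y k) - a * (y i * y j * x k + y i * y k * x j + y j * y k * x i
        + t * (y i * kron j k + y j * kron i k + y k * kron i j))
      + b * (kron i j * x k + kron i k * x j + x i * kron j k) := by
    intro i j k
    have h : ∀ l, x l * harm₄ n y i j k l =
        (y i * y j * y k - a * (y i * kron j k + y j * kron i k + y k * kron i j)) * (x l * y l)
        + (b * kron i j - a * y i * y j) * (x l * kron k l)
        + (b * kron i k - a * y i * y k) * (x l * kron j l)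
        + (b * kron j k - a * y j * y k) * (x l * kron i l) := by
      intro l
      simp only [harm₄]
      ring
    simp only [h, Finset.sum_add_distrib, ← Finset.mul_sum, sum_mul_kron, hxy]
    ring
  have c₂ : ∀ i j, ∑ k, x k * (t * (y i * y j * y k)
      - a * (y i * y j * x k + y i * y k * x j + y j * y k * x i
        + t * (y i * kron j k + y j * kron i k + y k * kron i j))
      + b * (kron i j * x k + kron i k * x j + x i * kron j k)) =
      t ^ 2 * (y i * y j) - a * (y i * y j + 2 * t * (y i * x j + y j * x i) + t ^ 2 * kron i j)
      + b * (kron i j + 2 * (x i * x j)) := by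
    intro i j
    have h : ∀ k, x k * (t * (y i * y j * y k)
        - a * (y i * y j * x k + y i * y k * x j + y j * y k * x i
          + t * (y i * kron j k + y j * kron i k + y k * kron i j))
        + b * (kron i j * x k + kron i k * x j + x i * kron j k)) =
        (t * (y i * y j) - a * (y i * x j + y j * x i + t * kron i j)) * (x k * y k)
        + (b * kron i j - a * y i * y j) * (x k * x k)
        + (b * x i - a * t * y i) * (x k * kron j k)
        + (b * x j - a * t * y j) * (x k * kron i k) := by
      intro k
      ring
    simp only [h, Finset.sum_add_distrib, ← Finset.mul_sum, sum_mul_kron, hxy, hx]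
    ring
  have c₃ : ∀ i, ∑ j, x j * (t ^ 2 * (y i * y j)
      - a * (y i * y j + 2 * t * (y i * x j + y j * x i) + t ^ 2 * kron i j)
      + b * (kron i j + 2 * (x i * x j))) =
      t ^ 3 * y i - a * (3 * t * y i + 3 * t ^ 2 * x i) + 3 * b * x i := by
    intro i
    have h : ∀ j, x j * (t ^ 2 * (y i * y j)
        - a * (y i * y j + 2 * t * (y i * x j + y j * x i) + t ^ 2 * kron i j)
        + b * (kron i j + 2 * (x i * x j))) =
        (t ^ 2 * y i - a * (y i + 2 * t * x i)) * (x j * y j)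
        + (2 * b * x i - 2 * a * t * y i) * (x j * x j)
        + (b - a * t ^ 2) * (x j * kron i j) := by
      intro j
      ring
    simp only [h, Finset.sum_add_distrib, ← Finset.mul_sum, sum_mul_kron, hxy, hx]
    ring
  have c₄ : ∑ i, x i * (t ^ 3 * y i - a * (3 * t * y i + 3 * t ^ 2 * x i) + 3 * b * x i) =
      t ^ 4 - 6 * a * t ^ 2 + 3 * b := by
    have h : ∀ i, x i * (t ^ 3 * y i - a * (3 * t * y i + 3 * t ^ 2 * x i) + 3 * b * x i) =
        (t ^ 3 - 3 * a * t) * (x i * y i) + (3 * b - 3 * a * t ^ 2) * (x i * x i) := by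
      intro i
      ring
    simp only [h, Finset.sum_add_distrib, ← Finset.mul_sum, hxy, hx]
    ring
  have e : ∑ i, ∑ j, ∑ k, ∑ l, x i * (x j * (x k * (x l * harm₄ n y i j k l))) =
      t ^ 4 - 6 * a * t ^ 2 + 3 * b := by
    simp only [← Finset.mul_sum, c₁, c₂, c₃, c₄]
  obtain ⟨z₃₄, z₂₄, z₂₃, z₁₄, z₁₃, z₁₂⟩ := sum_harm₄_mul_kron hy fun i j => x i * x j
  obtain ⟨w₃₄, w₂₄, w₂₃, -, -, -⟩ := sum_harm₄_mul_kron hy kron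
  have h : ∀ i j k l, harm₄ n x i j k l * harm₄ n y i j k l =
      x i * (x j * (x k * (x l * harm₄ n y i j k l)))
      - a * (x i * x j * (harm₄ n y i j k l * kron k l))
      - a * (x i * x k * (harm₄ n y i j k l * kron j l))
      - a * (x i * x l * (harm₄ n y i j k l * kron j k))
      - a * (x j * x k * (harm₄ n y i j k l * kron i l))
      - a * (x j * x l * (harm₄ n y i j k l * kron i k))
      - a * (x k * x l * (harm₄ n y i j k l * kron i j))
      + b * (kron i j * (harm₄ n y i j k l * kron k l))
      + b * (kron i k * (harm₄ n y i j k l * kron j l))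
      + b * (kron i l * (harm₄ n y i j k l * kron j k)) := by
    intro i j k l
    rw [harm₄]
    ring
  simp only [h, Finset.sum_sub_distrib, Finset.sum_add_distrib]
  simp only [← Finset.mul_sum] at e z₃₄ z₂₄ z₂₃ z₁₄ z₁₃ z₁₂ w₃₄ w₂₄ w₂₃ ⊢
  rw [e, z₃₄, z₂₄, z₂₃, z₁₄, z₁₃, z₁₂, w₃₄, w₂₄, w₂₃, ha, hb]
  ring

/-! ### The linear programming bound -/

/-- A kernel of the form `∑ p, T x p * T y p` is positive semidefinite. -/
lemma sum_sum_nonneg_of_eq_sum_mul {β κ : Type*} [Fintype κ] (C : Finset β) (K : β → β → ℝ)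
    (T : β → κ → ℝ) (hK : ∀ x ∈ C, ∀ y ∈ C, K x y = ∑ p, T x p * T y p) :
    0 ≤ ∑ x ∈ C, ∑ y ∈ C, K x y := by
  have h : ∑ x ∈ C, ∑ y ∈ C, K x y = ∑ p, (∑ x ∈ C, T x p) * (∑ y ∈ C, T y p) := by
    simp only [Finset.sum_mul_sum]
    rw [Finset.sum_comm]
    rw [Finset.sum_congr rfl fun x hx => Finset.sum_congr rfl fun y hy => hK y hy x hx]
    rw [Finset.sum_congr rfl fun x _ => Finset.sum_comm, Finset.sum_comm]
    exact Finset.sum_congr rfl fun p _ => Finset.sum_comm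
  rw [h]
  exact Finset.sum_nonneg fun p _ => mul_self_nonneg _

/-- Delsarte's linear programming bound in degree `4`: the coefficients `a₁, …, a₄` are those of
the monic Gegenbauer polynomials of degrees `1, …, 4`, and `f₀` is the constant coefficient. -/
theorem card_mul_le_of_gegenbauer (hn : n ≠ 0) {ℓ s : ℝ} {C : Finset (EuclideanSpace ℝ (Fin n))}
    (hC : IsCode n ℓ s C) {f : ℝ → ℝ} {f₀ a₁ a₂ a₃ a₄ : ℝ}
    (ha₁ : 0 ≤ a₁) (ha₂ : 0 ≤ a₂) (ha₃ : 0 ≤ a₃) (ha₄ : 0 ≤ a₄)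
    (hf : ∀ t, f t = f₀ + a₁ * t + a₂ * (t ^ 2 - 1 / n) + a₃ * (t ^ 3 - 3 / ((n : ℝ) + 2) * t)
      + a₄ * (t ^ 4 - 6 / ((n : ℝ) + 4) * t ^ 2 + 3 / (((n : ℝ) + 2) * (n + 4))))
    (hneg : ∀ t, ℓ ≤ t → t ≤ s → f t ≤ 0) :
    C.card * f₀ ≤ f 1 := by
  obtain ⟨hne, hunit, hin⟩ := hC
  have hinner : ∀ x y : EuclideanSpace ℝ (Fin n), ∑ i, x i * y i = inner ℝ x y := by
    intro x y
    simp [PiLp.inner_apply, mul_comm]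
  have hself : ∀ x ∈ C, ∑ i, x i * x i = 1 := by
    intro x hx
    rw [hinner, real_inner_self_eq_norm_sq, hunit x hx, one_pow]
  have p₁ : 0 ≤ ∑ x ∈ C, ∑ y ∈ C, inner ℝ x y :=
    sum_sum_nonneg_of_eq_sum_mul C _ (fun x i => x i) fun x _ y _ => (hinner x y).symm
  have p₂ : 0 ≤ ∑ x ∈ C, ∑ y ∈ C, ((inner ℝ x y) ^ 2 - 1 / (n : ℝ)) := by
    refine sum_sum_nonneg_of_eq_sum_mul C _
      (fun x (p : Fin n × Fin n) => harm₂ n x p.1 p.2) fun x hx y hy => ?_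
    rw [← sum_harm₂_mul hn (hself x hx) (hself y hy) (hinner x y)]
    simp only [Fintype.sum_prod_type]
  have p₃ : 0 ≤ ∑ x ∈ C, ∑ y ∈ C,
      ((inner ℝ x y) ^ 3 - 3 / ((n : ℝ) + 2) * inner ℝ x y) := by
    refine sum_sum_nonneg_of_eq_sum_mul C _
      (fun x (p : Fin n × Fin n × Fin n) => harm₃ n x p.1 p.2.1 p.2.2) fun x hx y hy => ?_
    rw [← sum_harm₃_mul (hself x hx) (hself y hy) (hinner x y)]
    simp only [Fintype.sum_prod_type]
  have p₄ : 0 ≤ ∑ x ∈ C, ∑ y ∈ C, ((inner ℝ x y) ^ 4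
      - 6 / ((n : ℝ) + 4) * (inner ℝ x y) ^ 2 + 3 / (((n : ℝ) + 2) * (n + 4))) := by
    refine sum_sum_nonneg_of_eq_sum_mul C _
      (fun x (p : Fin n × Fin n × Fin n × Fin n) => harm₄ n x p.1 p.2.1 p.2.2.1 p.2.2.2)
      fun x hx y hy => ?_
    rw [← sum_harm₄_mul (hself x hx) (hself y hy) (hinner x y)]
    simp only [Fintype.sum_prod_type]
  have hsum : ∑ x ∈ C, ∑ y ∈ C, f (inner ℝ x y) = C.card * C.card * f₀
      + a₁ * ∑ x ∈ C, ∑ y ∈ C, inner ℝ x y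
      + a₂ * ∑ x ∈ C, ∑ y ∈ C, ((inner ℝ x y) ^ 2 - 1 / (n : ℝ))
      + a₃ * ∑ x ∈ C, ∑ y ∈ C, ((inner ℝ x y) ^ 3 - 3 / ((n : ℝ) + 2) * inner ℝ x y)
      + a₄ * ∑ x ∈ C, ∑ y ∈ C, ((inner ℝ x y) ^ 4
        - 6 / ((n : ℝ) + 4) * (inner ℝ x y) ^ 2 + 3 / (((n : ℝ) + 2) * (n + 4))) := by
    simp only [hf, Finset.mul_sum]
    simp only [Finset.sum_add_distrib, Finset.sum_const, nsmul_eq_mul]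
    ring
  have hle : ∑ x ∈ C, ∑ y ∈ C, f (inner ℝ x y) ≤ C.card * f 1 := by
    rw [← nsmul_eq_mul]
    refine Finset.sum_le_card_nsmul _ _ _ fun x hx => ?_
    rw [← Finset.add_sum_erase C _ hx, real_inner_self_eq_norm_sq, hunit x hx, one_pow]
    have : ∑ y ∈ C.erase x, f (inner ℝ x y) ≤ 0 := by
      refine Finset.sum_nonpos fun y hy => ?_
      obtain ⟨hyx, hy⟩ := Finset.mem_erase.1 hy
      obtain ⟨h₁, h₂⟩ := hin x hx y hy (Ne.symm hyx)
      exact hneg _ h₁ h₂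
    linarith
  have hcard : (0 : ℝ) < C.card := by exact_mod_cast hne.card_pos
  have := mul_nonneg ha₁ p₁
  have := mul_nonneg ha₂ p₂
  have := mul_nonneg ha₃ p₃
  have := mul_nonneg ha₄ p₄
  refine le_of_mul_le_mul_left ?_ hcard
  linarith

end Tensors

lemma maxCard_le_of_forall_card_le {n : ℕ} {ℓ s B : ℝ}
    (h : ∀ K, IsCode n ℓ s K → (K.card : ℝ) ≤ B) :
    ((maxCard n ℓ s : ℕ∞) : ENNReal) ≤ ENNReal.ofReal B := by
  have hle : maxCard n ℓ s ≤ (⌊B⌋₊ : ℕ∞) :=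
    iSup₂_le fun K hK => by exact_mod_cast Nat.le_floor (h K hK)
  rcases le_or_gt 0 B with hB | hB
  · calc ((maxCard n ℓ s : ℕ∞) : ENNReal) ≤ ((⌊B⌋₊ : ℕ∞) : ENNReal) :=
        ENat.toENNReal_mono hle
      _ = ENNReal.ofReal (⌊B⌋₊ : ℝ) := by rw [ENat.toENNReal_coe, ENNReal.ofReal_natCast]
      _ ≤ ENNReal.ofReal B := ENNReal.ofReal_le_ofReal (Nat.floor_le hB)
  · rw [Nat.floor_of_nonpos hB.le] at hle
    have h0 : maxCard n ℓ s = 0 := by simpa using hle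
    simp [h0]

/-! ### Orthogonal polynomials of low degree -/

lemma monicOrth_zero (n : ℕ) (w : ℝ[X]) : monicOrth n w 0 = 1 := by
  rw [monicOrth]
  simp

lemma monicOrth_one (n : ℕ) (w : ℝ[X]) :
    monicOrth n w 1 = X - C (zerothCoeff n (X * w) / zerothCoeff n w) := by
  rw [monicOrth]
  simp [monicOrth_zero]

lemma monicOrth_two (n : ℕ) (w : ℝ[X]) :
    monicOrth n w 2 = X ^ 2 - (C (zerothCoeff n (X ^ 2 * w) / zerothCoeff n w) +
      C (zerothCoeff n (X ^ 2 * monicOrth n w 1 * w) /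
        zerothCoeff n (monicOrth n w 1 * monicOrth n w 1 * w)) * monicOrth n w 1) := by
  rw [monicOrth]
  simp [Fin.sum_univ_two, monicOrth_zero]

/-- The monic orthogonal polynomial of degree `2` of a quadratic weight, by Cramer's rule in the
moments `M₀, …, M₃` of the weight. -/
lemma eval_monicOrth_two (n : ℕ) (hn : 2 ≤ n) (w : ℝ[X]) {c₀ c₁ c₂ M₀ M₁ M₂ M₃ : ℝ}
    (hw : ∀ t, w.eval t = c₀ + c₁ * t + c₂ * t ^ 2)
    (h₀ : M₀ = c₀ + c₂ / n) (h₁ : M₁ = c₁ / n) (h₂ : M₂ = c₀ / n + 3 * c₂ / (n * (n + 2)))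
    (h₃ : M₃ = 3 * c₁ / (n * (n + 2))) (hM₀ : M₀ ≠ 0) (hdet : M₀ * M₂ - M₁ ^ 2 ≠ 0) (t : ℝ) :
    (M₀ * M₂ - M₁ ^ 2) * (monicOrth n w 2).eval t =
      (M₀ * M₂ - M₁ ^ 2) * t ^ 2 + (M₁ * M₂ - M₀ * M₃) * t + (M₁ * M₃ - M₂ ^ 2) := by
  have z₀ : zerothCoeff n w = M₀ := by
    rw [zerothCoeff_of_eval_eq n hn w c₀ c₁ c₂ 0 0 0 (fun t => by rw [hw]; ring), h₀]
    ring
  have z₁ : zerothCoeff n (X * w) = M₁ := by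
    rw [zerothCoeff_of_eval_eq n hn _ 0 c₀ c₁ c₂ 0 0
      (fun t => by simp only [eval_mul, eval_X, hw]; ring), h₁]
    ring
  have z₂ : zerothCoeff n (X ^ 2 * w) = M₂ := by
    rw [zerothCoeff_of_eval_eq n hn _ 0 0 c₀ c₁ c₂ 0
      (fun t => by simp only [eval_mul, eval_pow, eval_X, hw]; ring), h₂]
    ring
  have hQ : monicOrth n w 1 = X - C (M₁ / M₀) := by rw [monicOrth_one, z₁, z₀]
  set x := M₁ / M₀ with hx
  have z₃ : zerothCoeff n (X ^ 2 * monicOrth n w 1 * w) = M₃ - x * M₂ := by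
    rw [hQ, zerothCoeff_of_eval_eq n hn _ 0 0 (-x * c₀) (c₀ - x * c₁) (c₁ - x * c₂) c₂
      (fun t => by simp only [eval_mul, eval_sub, eval_pow, eval_X, eval_C, hw]; ring), h₂, h₃]
    ring
  have z₄ : zerothCoeff n (monicOrth n w 1 * monicOrth n w 1 * w) =
      M₂ - 2 * x * M₁ + x ^ 2 * M₀ := by
    rw [hQ, zerothCoeff_of_eval_eq n hn _ (x ^ 2 * c₀) (x ^ 2 * c₁ - 2 * x * c₀)
      (x ^ 2 * c₂ - 2 * x * c₁ + c₀) (c₁ - 2 * x * c₂) c₂ 0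
      (fun t => by simp only [eval_mul, eval_sub, eval_X, eval_C, hw]; ring), h₀, h₁, h₂]
    ring
  have z₄' : M₂ - 2 * x * M₁ + x ^ 2 * M₀ = (M₀ * M₂ - M₁ ^ 2) / M₀ := by
    rw [hx]
    field_simp
    ring
  rw [monicOrth_two, z₀, z₂, z₃, z₄, z₄', hQ]
  simp only [eval_sub, eval_add, eval_mul, eval_pow, eval_X, eval_C]
  rw [hx]
  generalize hd : M₀ * M₂ - M₁ ^ 2 = d at hdet ⊢
  field_simp
  subst hd
  ring

lemma eval_monicOrth_two_one_sub (n : ℕ) (hn : 2 ≤ n) (t : ℝ) :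
    ((n : ℝ) + 2) * (monicOrth n (1 - X) 2).eval t = (n + 2) * t ^ 2 + 2 * t - 1 := by
  have hn' : (2 : ℝ) ≤ n := by exact_mod_cast hn
  have hdet : 1 * (1 / (n : ℝ)) - (-1 / (n : ℝ)) ^ 2 ≠ 0 := by
    have : 1 * (1 / (n : ℝ)) - (-1 / (n : ℝ)) ^ 2 = (n - 1) / n ^ 2 := by field_simp
    rw [this]
    exact div_ne_zero (by linarith) (by positivity)
  have h := eval_monicOrth_two n hn (1 - X) (c₀ := 1) (c₁ := -1) (c₂ := 0) (M₀ := 1)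
    (M₁ := -1 / n) (M₂ := 1 / n) (M₃ := 3 * (-1) / (n * (n + 2)))
    (fun t => by simp only [eval_sub, eval_one, eval_X]; ring) (by simp) rfl (by simp) rfl
    one_ne_zero hdet t
  have h1 : (n : ℝ) - 1 ≠ 0 := by linarith
  field_simp at h
  refine mul_left_cancel₀ h1 ?_
  linear_combination h

/-- The orthogonal polynomial of degree `2` for `(t - ℓ)(1 - t) dμ(t)`, cleared of denominators. -/
lemma eval_monicOrth_two_sub_mul_one_sub (n : ℕ) (hn : 2 ≤ n) {ℓ : ℝ}
    (h₀ : (n : ℝ) * ℓ + 1 ≠ 0) (hQ : ((n : ℝ) + 2) * ℓ ^ 2 + 2 * ℓ - 1 ≠ 0) (t : ℝ) :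
    ((n : ℝ) + 2) * ((n + 2) * ℓ ^ 2 + 2 * ℓ - 1) *
        (monicOrth n ((X - C ℓ) * (1 - X)) 2).eval t =
      (n + 2) * ((n + 2) * ℓ ^ 2 + 2 * ℓ - 1) * t ^ 2 + 2 * (n + 2) * ℓ * (1 + ℓ) * t
        - ((n + 2) * ℓ ^ 2 - 3) := by
  have hn' : (2 : ℝ) ≤ n := by exact_mod_cast hn
  have h1 : (n : ℝ) - 1 ≠ 0 := by linarith
  have hM₀ : -ℓ + -1 / (n : ℝ) ≠ 0 := by
    have : -ℓ + -1 / (n : ℝ) = -(n * ℓ + 1) / n := by field_simp; ring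
    rw [this]
    exact div_ne_zero (neg_ne_zero.2 h₀) (by positivity)
  have hdet_eq : (-ℓ + -1 / (n : ℝ)) * (-ℓ / n + 3 * (-1) / (n * (n + 2)))
      - ((1 + ℓ) / (n : ℝ)) ^ 2 =
      (n - 1) * ((n + 2) * ℓ ^ 2 + 2 * ℓ - 1) / (n ^ 2 * (n + 2)) := by
    field_simp
    ring
  have h := eval_monicOrth_two n hn ((X - C ℓ) * (1 - X)) (c₀ := -ℓ) (c₁ := 1 + ℓ) (c₂ := -1)
    (fun t => by simp only [eval_mul, eval_sub, eval_one, eval_X, eval_C]; ring) rfl rfl rfl rfl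
    hM₀ (by rw [hdet_eq]; exact div_ne_zero (mul_ne_zero h1 hQ) (by positivity)) t
  rw [hdet_eq] at h
  generalize (monicOrth n ((X - C ℓ) * (1 - X)) 2).eval t = E at h ⊢
  field_simp at h
  refine mul_left_cancel₀ h1 ?_
  linear_combination h

lemma monicOrth_one_sub_mul_sub_mul_one_sub (n : ℕ) (hn : 2 ≤ n) (ℓ s : ℝ) :
    monicOrth n ((X - C ℓ) * (C s - X) * (1 - X)) 1 =
      X - C (-((3 + (n + 2) * (ℓ * s + ℓ + s)) / ((n + 2) * (n * ℓ * s + ℓ + s + 1)))) := by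
  have hn' : (2 : ℝ) ≤ n := by exact_mod_cast hn
  rw [monicOrth_one,
    zerothCoeff_of_eval_eq n hn _ 0 (-(ℓ * s)) (ℓ * s + ℓ + s) (-(1 + ℓ + s)) 1 0
      (fun t => by simp only [eval_mul, eval_sub, eval_one, eval_X, eval_C]; ring),
    zerothCoeff_of_eval_eq n hn _ (-(ℓ * s)) (ℓ * s + ℓ + s) (-(1 + ℓ + s)) 1 0 0
      (fun t => by simp only [eval_mul, eval_sub, eval_one, eval_X, eval_C]; ring)]
  congr 2
  have e₁ : (0 : ℝ) + (ℓ * s + ℓ + s) / n + 3 * 1 / (n * (n + 2)) =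
      (3 + (n + 2) * (ℓ * s + ℓ + s)) / (n * (n + 2)) := by
    field_simp
    ring
  have e₂ : -(ℓ * s) + -(1 + ℓ + s) / n + 3 * 0 / ((n : ℝ) * (n + 2)) =
      -(n * ℓ * s + ℓ + s + 1) / n := by
    field_simp
    ring
  rw [e₁, e₂]
  -- if `n ℓ s + ℓ + s + 1 = 0`, both quotients are divisions by zero and hence equal to `0`
  by_cases hD : (n : ℝ) * ℓ * s + ℓ + s + 1 = 0
  · simp [hD]
  · field_simp

/-! ### The sign of the zeroth coefficient -/

/-- With `r = √(N + 3)`, the zeros of `(N + 2) t² + 2 t - 1` are `-1 / (r - 1)` and `1 / (r + 1)`;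
a pair `ℓ, s` on either side of them has `∫ (t - ℓ)(s - t)(1 - t) dμ > 0`, an integral that equals
`-(N ℓ s + ℓ + s + 1) / N`. -/
lemma weight_mass_pos {r ℓ s : ℝ} (hr : 2 < r) (hℓ : ℓ < -1 / (r - 1)) (hs : 1 / (r + 1) < s) :
    (r ^ 2 - 3) * ℓ * s + ℓ + s + 1 < 0 := by
  have hℓ' : ℓ * (r - 1) < -1 := (lt_div_iff₀ (by linarith)).1 hℓ
  have hs' : 1 < s * (r + 1) := (div_lt_iff₀ (by linarith)).1 hs
  have hℓ₀ : ℓ < 0 := by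
    by_contra h
    nlinarith [mul_nonneg (not_lt.1 h) (show 0 ≤ r - 1 by linarith)]
  have h₁ : (r ^ 2 - 3) * ℓ + 1 < 0 := by
    nlinarith [mul_pos (neg_pos.2 hℓ₀)
      (mul_pos (show 0 < r - 2 by linarith) (show 0 < r + 1 by linarith))]
  have h₂ : (ℓ * (r - 1) + 1) * (r + 2) < 0 := mul_neg_of_neg_of_pos (by linarith) (by linarith)
  have h₃ : ((r ^ 2 - 3) * ℓ + 1) * (s * (r + 1) - 1) < 0 :=
    mul_neg_of_neg_of_pos h₁ (by linarith)
  have h₄ : ((r ^ 2 - 3) * ℓ * s + ℓ + s + 1) * (r + 1) < 0 := by nlinarith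
  exact neg_of_mul_neg_left h₄ (by linarith)

/-- The denominator of the bound. It is `n (n + 2) (n ℓ s + ℓ + s + 1) ∫ (t - ℓ)(t - s)(t - α) dμ`,
with `N` in place of `n`. -/
def boundDenom (N ℓ s : ℝ) : ℝ :=
  (N + 2) * (N * ℓ ^ 2 * s ^ 2 - (ℓ - s) ^ 2) - 6 * ℓ * s + 3

/-- `boundDenom` is a strictly convex quadratic in `s`, so it is negative between two points where
it is nonpositive. -/
lemma boundDenom_neg_of_mem_Ioo {N ℓ s u v : ℝ} (hN : 0 < N + 2) (hℓ : 1 < N * ℓ ^ 2)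
    (hu : boundDenom N ℓ u ≤ 0) (hv : boundDenom N ℓ v ≤ 0) (hus : u < s) (hsv : s < v) :
    boundDenom N ℓ s < 0 := by
  have h : (v - u) * boundDenom N ℓ s = (v - s) * boundDenom N ℓ u + (s - u) * boundDenom N ℓ v
      - (N + 2) * (N * ℓ ^ 2 - 1) * ((v - u) * ((s - u) * (v - s))) := by
    simp only [boundDenom]
    ring
  have h₁ : 0 < (N + 2) * (N * ℓ ^ 2 - 1) * ((v - u) * ((s - u) * (v - s))) :=
    mul_pos (mul_pos hN (by linarith))
      (mul_pos (by linarith) (mul_pos (by linarith) (by linarith)))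
  have h₂ := mul_nonneg (show 0 ≤ v - s by linarith) (neg_nonneg.2 hu)
  have h₃ := mul_nonneg (show 0 ≤ s - u by linarith) (neg_nonneg.2 hv)
  have h₄ : (v - u) * boundDenom N ℓ s < 0 := by linarith
  exact neg_of_mul_neg_right h₄ (by linarith)

/-- At the lower end `s = t_{2,2}^{1,0}` of the range of `s`, the denominator is negative. -/
lemma boundDenom_neg_left {r ℓ : ℝ} (hr : 2 < r) (hℓ : ℓ < -1 / (r - 1)) :
    boundDenom (r ^ 2 - 3) ℓ (1 / (r + 1)) < 0 := by
  have hℓ' : ℓ * (r - 1) < -1 := (lt_div_iff₀ (by linarith)).1 hℓ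
  have hr1 : r + 1 ≠ 0 := by linarith
  have hℓ₀ : ℓ < 0 := hℓ.trans (div_neg_of_neg_of_pos (by norm_num) (by linarith))
  have h : boundDenom (r ^ 2 - 3) ℓ (1 / (r + 1)) =
      2 * (1 - ℓ) * (r + 2) * (ℓ * (r - 1) + 1) / (r + 1) := by
    simp only [boundDenom]
    field_simp
    ring
  rw [h]
  refine div_neg_of_neg_of_pos (mul_neg_of_pos_of_neg ?_ (by linarith)) (by linarith)
  exact mul_pos (mul_pos two_pos (by linarith)) (by linarith)

/-- The sign of the denominator in the range `ℓ < t_{2,1}^{1,0}`, `t_{2,2}^{1,0} < s`. The zeros of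
`P_2^{1,ℓ}` have opposite signs when `(N + 2) ℓ² > 3`. In that case the bound of `s` by a zero `t`
of `P_2^{1,ℓ}` suffices. Otherwise nonnegativity of the cubic Gegenbauer coefficient forces
`s < -ℓ`, and this suffices in turn. -/
lemma boundDenom_neg {r ℓ s : ℝ} (hr : 2 < r) (hℓ₁ : -1 ≤ ℓ)
    (hℓ : ℓ < -1 / (r - 1)) (hs : 1 / (r + 1) < s)
    (h₃ : ℓ + s + 2 * -((3 + (r ^ 2 - 1) * (ℓ * s + ℓ + s)) /
      ((r ^ 2 - 1) * ((r ^ 2 - 3) * ℓ * s + ℓ + s + 1))) ≤ 0)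
    (hroot : 3 ≤ (r ^ 2 - 1) * ℓ ^ 2 → ∃ t, s < t ∧
      (r ^ 2 - 1) * ((r ^ 2 - 1) * ℓ ^ 2 + 2 * ℓ - 1) * t ^ 2 + 2 * (r ^ 2 - 1) * ℓ * (1 + ℓ) * t
        - ((r ^ 2 - 1) * ℓ ^ 2 - 3) = 0) :
    boundDenom (r ^ 2 - 3) ℓ s < 0 := by
  have hℓ' : ℓ * (r - 1) < -1 := (lt_div_iff₀ (by linarith)).1 hℓ
  have hℓ₀ : ℓ < 0 := hℓ.trans (div_neg_of_neg_of_pos (by norm_num) (by linarith))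
  have hsq : 1 < (r - 1) ^ 2 * ℓ ^ 2 := by nlinarith
  have hNℓ : 1 < (r ^ 2 - 3) * ℓ ^ 2 := by nlinarith [sq_nonneg ℓ]
  have hN : 0 < r ^ 2 - 1 := by nlinarith
  have hleft := boundDenom_neg_left hr hℓ
  have hD := weight_mass_pos hr hℓ hs
  by_cases hcase : 3 ≤ (r ^ 2 - 1) * ℓ ^ 2
  · obtain ⟨t, hst, ht⟩ := hroot hcase
    have hDt := weight_mass_pos hr hℓ (hs.trans hst)
    have hQ : 0 < (r ^ 2 - 1) * ℓ ^ 2 + 2 * ℓ - 1 := by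
      have : (r ^ 2 - 1) * ℓ ^ 2 + 2 * ℓ - 1 = (ℓ * (r - 1) + 1) * (ℓ * (r + 1) - 1) := by ring
      rw [this]
      exact mul_pos_of_neg_of_neg (by linarith) (by nlinarith)
    have hid : ((r ^ 2 - 1) * ℓ ^ 2 + 2 * ℓ - 1) * boundDenom (r ^ 2 - 3) ℓ t =
        -(2 * (((r ^ 2 - 3) * ℓ * t + ℓ + t + 1) * ℓ) * ((r ^ 2 - 1) * ℓ ^ 2 - 3)) := by
      simp only [boundDenom]
      linear_combination ((r ^ 2 - 3) * ℓ ^ 2 - 1) * ht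
    have hDt' : boundDenom (r ^ 2 - 3) ℓ t ≤ 0 := by
      refine nonpos_of_mul_nonpos_right (a := (r ^ 2 - 1) * ℓ ^ 2 + 2 * ℓ - 1) ?_ hQ
      rw [hid, neg_nonpos]
      exact mul_nonneg (mul_nonneg zero_le_two (mul_nonneg_of_nonpos_of_nonpos hDt.le hℓ₀.le))
        (by linarith)
    exact boundDenom_neg_of_mem_Ioo (by linarith) hNℓ hleft.le hDt' hs hst
  · rw [not_le] at hcase
    have hsℓ : s < -ℓ := by
      by_contra hcon
      rw [not_lt] at hcon
      have hnum : 0 < 3 + (r ^ 2 - 1) * (ℓ * s + ℓ + s) := by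
        have : 0 ≤ (r ^ 2 - 1) * ((1 + ℓ) * (s + ℓ)) :=
          mul_nonneg hN.le (mul_nonneg (by linarith only [hℓ₁]) (by linarith))
        nlinarith
      have := div_neg_of_pos_of_neg hnum (mul_neg_of_pos_of_neg hN hD)
      linarith
    have hright : boundDenom (r ^ 2 - 3) ℓ (-ℓ) ≤ 0 := by
      have h : boundDenom (r ^ 2 - 3) ℓ (-ℓ) =
          ((r ^ 2 - 3) * ℓ ^ 2 - 1) * ((r ^ 2 - 1) * ℓ ^ 2 - 3) := by
        simp only [boundDenom]
        ring
      rw [h]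
      exact mul_nonpos_of_nonneg_of_nonpos (by linarith) (by linarith)
    exact boundDenom_neg_of_mem_Ioo (by linarith) hNℓ hleft.le hright hs hsℓ

/-- If `(n + 2) ℓ² ≥ 3`, the orthogonal polynomial of degree `2` for `(t - ℓ)(1 - t) dμ(t)` is
positive at `1`, so that it can be normalized there. -/
lemma eval_one_pos_of_three_le {r ℓ : ℝ} (hr : 2 < r)
    (h : 3 ≤ (r ^ 2 - 1) * ℓ ^ 2) :
    0 < (r ^ 2 - 1) * ((r ^ 2 - 1) * ℓ ^ 2 + 2 * ℓ - 1) + 2 * (r ^ 2 - 1) * ℓ * (1 + ℓ)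
      - ((r ^ 2 - 1) * ℓ ^ 2 - 3) := by
  set E := (r ^ 2 - 1) * ((r ^ 2 - 1) * ℓ ^ 2 + 2 * ℓ - 1) + 2 * (r ^ 2 - 1) * ℓ * (1 + ℓ)
    - ((r ^ 2 - 1) * ℓ ^ 2 - 3) with hE
  have hm : 3 < r ^ 2 - 1 := by nlinarith
  -- completing the square in `√(r² - 1)`
  have key : ((r ^ 2 - 1) * ℓ ^ 2 - 1) * E =
      (r ^ 2 - 1) * ((r ^ 2 - 1) * ℓ ^ 2 - 1 + 2 * ℓ) ^ 2 +
        ((r ^ 2 - 1) * ℓ ^ 2 - 3) * ((r ^ 2 - 1) * ℓ ^ 2 + 1) := by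
    rw [hE]
    ring
  refine pos_of_mul_pos_right (a := (r ^ 2 - 1) * ℓ ^ 2 - 1) ?_ (by linarith)
  rw [key]
  have hsq : 0 ≤ (r ^ 2 - 1) * ((r ^ 2 - 1) * ℓ ^ 2 - 1 + 2 * ℓ) ^ 2 :=
    mul_nonneg (by linarith) (sq_nonneg _)
  rcases h.lt_or_eq with h | h
  · have : 0 < ((r ^ 2 - 1) * ℓ ^ 2 - 3) * ((r ^ 2 - 1) * ℓ ^ 2 + 1) :=
      mul_pos (by linarith) (by linarith)
    linarith
  · have hne : (r ^ 2 - 1) * ℓ ^ 2 - 1 + 2 * ℓ ≠ 0 := by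
      intro h0
      have hℓ : ℓ = -1 := by linarith
      rw [hℓ] at h
      linarith
    have := mul_pos (show 0 < r ^ 2 - 1 by linarith) (sq_pos_iff.2 hne)
    have hz : ((r ^ 2 - 1) * ℓ ^ 2 - 3) * ((r ^ 2 - 1) * ℓ ^ 2 + 1) = 0 := by
      rw [← h]
      ring
    linarith

/-- In the range of `s` given by the zeros of `P_2^{1,0}` and `P_2^{1,ℓ}`, the polynomial
`(t - ℓ)(s - t)` has positive integral with respect to `(1 - t) dμ(t)`, and the denominator of
the bound is negative. -/
lemma neg_of_inRange (n : ℕ) (hn : 2 ≤ n) {ℓ s : ℝ} (hℓ : -1 ≤ ℓ)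
    (hdom : InRange n 2 ℓ s)
    (h₃ : ℓ + s + 2 * -((3 + (n + 2) * (ℓ * s + ℓ + s)) /
      ((n + 2) * (n * ℓ * s + ℓ + s + 1))) ≤ 0) :
    (n : ℝ) * ℓ * s + ℓ + s + 1 < 0 ∧ boundDenom n ℓ s < 0 := by
  have hn' : (2 : ℝ) ≤ n := by exact_mod_cast hn
  obtain ⟨hlow, hhigh, t, ht, hst⟩ := hdom
  set r := Real.sqrt ((n : ℝ) + 3) with hr
  have hr2 : r ^ 2 = n + 3 := Real.sq_sqrt (by positivity)
  have hr_gt : 2 < r := by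
    rw [hr]
    exact Real.lt_sqrt_of_sq_lt (by linarith)
  have hN : (n : ℝ) = r ^ 2 - 3 := by linarith
  have hN2 : (n : ℝ) + 2 = r ^ 2 - 1 := by linarith
  have root : ∀ x : ℝ, ((n : ℝ) + 2) * x ^ 2 + 2 * x - 1 = 0 → (P10 n 2).IsRoot x := by
    intro x hx
    have h := eval_monicOrth_two_one_sub n hn x
    rw [hx] at h
    have h' := (mul_eq_zero.1 h).resolve_left (by positivity)
    simp [P10, orthPoly, h']
  have hr₁ : r - 1 ≠ 0 := by linarith
  have hr₂ : r + 1 ≠ 0 := by linarith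
  have hℓ' : ℓ < -1 / (r - 1) := by
    refine hlow _ (root _ ?_)
    rw [hN2]
    field_simp
    ring
  have hs' : 1 / (r + 1) < s := by
    refine hhigh _ (root _ ?_)
    rw [hN2]
    field_simp
    ring
  have hD := weight_mass_pos hr_gt hℓ' hs'
  rw [hN2, hN] at h₃
  rw [hN]
  refine ⟨hD, boundDenom_neg hr_gt hℓ hℓ' hs' h₃ fun hcase => ⟨t, hst, ?_⟩⟩
  have hℓr : ℓ * (r - 1) < -1 := (lt_div_iff₀ (by linarith)).1 hℓ'
  have hℓ₀ : ℓ < 0 := hℓ'.trans (div_neg_of_neg_of_pos (by norm_num) (by linarith))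
  have hQ : 0 < (r ^ 2 - 1) * ℓ ^ 2 + 2 * ℓ - 1 := by
    have : (r ^ 2 - 1) * ℓ ^ 2 + 2 * ℓ - 1 = (ℓ * (r - 1) + 1) * (ℓ * (r + 1) - 1) := by ring
    rw [this]
    exact mul_pos_of_neg_of_neg (by linarith) (by nlinarith)
  have hM : (n : ℝ) * ℓ + 1 ≠ 0 := by
    rw [hN]
    nlinarith [mul_pos (neg_pos.2 hℓ₀)
      (mul_pos (show 0 < r - 2 by linarith) (show 0 < r + 1 by linarith))]
  have hE := eval_monicOrth_two_sub_mul_one_sub n hn hM (by rw [hN2]; exact hQ.ne')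
  rw [hN2] at hE
  have h1 : (monicOrth n ((X - C ℓ) * (1 - X)) 2).eval 1 ≠ 0 := by
    intro h0
    have h := hE 1
    rw [h0] at h
    have := eval_one_pos_of_three_le hr_gt hcase
    linarith
  rw [← hE t]
  simp only [P1l, orthPoly, IsRoot.def, eval_mul, eval_C] at ht
  rw [(mul_eq_zero.1 ht).resolve_left (inv_ne_zero h1), mul_zero]

end SphericalCode

end

/-! ### The bound for codes -/

theorem mainTheorem9 (n : ℕ) (hn : 2 ≤ n) (ℓ s α : ℝ)
    (hℓ : -1 ≤ ℓ) (hℓs : ℓ < s) (hs : s < 1)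
    (hα : α = -((3 + (n + 2) * (ℓ * s + ℓ + s)) / ((n + 2) * (n * ℓ * s + ℓ + s + 1))))
    (hdom : SphericalCode.InRange n 2 ℓ s ∨
      ((n : ℝ) * ℓ * s + ℓ + s + 1 ≠ 0 ∧
        0 < SphericalCode.zerothCoeff n (SphericalCode.levPoly n 2 ℓ s)))
    (h1 : ℓ + s + 2 * α ≤ 0)
    (h2 : 0 ≤ α ^ 2 + 2 * (ℓ + s) * α + ℓ * s + 6 / ((n : ℝ) + 4))
    (h3 : (ℓ + s) * α ^ 2 + 2 * α * (ℓ * s + 3 / ((n : ℝ) + 2))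
      + 3 * (ℓ + s) / ((n : ℝ) + 2) ≤ 0) :
    (∀ t : ℝ, (SphericalCode.P1ls n ℓ s 1).eval t = 0 ↔ t = α) ∧
    0 < SphericalCode.zerothCoeff n (SphericalCode.levPoly n 2 ℓ s) ∧
    ((SphericalCode.maxCard n ℓ s : ℕ∞) : ENNReal) ≤
      ENNReal.ofReal ((SphericalCode.levPoly n 2 ℓ s).eval 1 /
        SphericalCode.zerothCoeff n (SphericalCode.levPoly n 2 ℓ s)) ∧
    (SphericalCode.levPoly n 2 ℓ s).eval 1 /
        SphericalCode.zerothCoeff n (SphericalCode.levPoly n 2 ℓ s) =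
      n * (1 - ℓ) * (1 - s) *
          (3 + (n + 2) * (n * ℓ * s + ℓ * s + 2 * ℓ + 2 * s + 1)) /
        ((n + 2) * (n * ℓ ^ 2 * s ^ 2 - (ℓ - s) ^ 2) - 6 * ℓ * s + 3) := by
  open SphericalCode in
  have hn' : (2 : ℝ) ≤ n := by exact_mod_cast hn
  have hα1 : 0 < 1 - α := by linarith
  have hP : ∀ t, (P1ls n ℓ s 1).eval t = (1 - α)⁻¹ * (t - α) := by
    intro t
    rw [P1ls, orthPoly, monicOrth_one_sub_mul_sub_mul_one_sub n hn, ← hα]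
    simp only [eval_mul, eval_sub, eval_C, eval_X]
  have hf : ∀ t, (levPoly n 2 ℓ s).eval t = (t - ℓ) * (t - s) * ((1 - α)⁻¹ * (t - α)) ^ 2 := by
    intro t
    simp only [levPoly, eval_mul, eval_sub, eval_C, eval_X, eval_pow, hP]
  set κ := (1 - α)⁻¹ with hκ
  have hκ0 : 0 < κ := inv_pos.2 hα1
  have hf₀ : zerothCoeff n (levPoly n 2 ℓ s) = κ ^ 2 * (ℓ * s * α ^ 2 +
      (α ^ 2 + 2 * (ℓ + s) * α + ℓ * s) / n + 3 / (n * (n + 2))) := by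
    rw [zerothCoeff_of_eval_eq n hn _ (κ ^ 2 * (ℓ * s * α ^ 2))
      (-(κ ^ 2 * ((ℓ + s) * α ^ 2 + 2 * α * (ℓ * s))))
      (κ ^ 2 * (α ^ 2 + 2 * (ℓ + s) * α + ℓ * s)) (-(κ ^ 2 * (ℓ + s + 2 * α))) (κ ^ 2) 0
      (fun t => by rw [hf]; ring)]
    ring
  have hαD : (n : ℝ) * ℓ * s + ℓ + s + 1 ≠ 0 →
      α * ((n + 2) * (n * ℓ * s + ℓ + s + 1)) = -(3 + (n + 2) * (ℓ * s + ℓ + s)) := by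
    intro hD
    rw [hα, neg_mul, div_mul_cancel₀ _ (mul_ne_zero (by positivity) hD)]
  -- by orthogonality, one factor `t - α` under the integral may be replaced by `1 - α`
  have hF : (n : ℝ) * ℓ * s + ℓ + s + 1 ≠ 0 → zerothCoeff n (levPoly n 2 ℓ s) =
      κ * (boundDenom n ℓ s / (n * ((n + 2) * (n * ℓ * s + ℓ + s + 1)))) := by
    intro hD
    have hα' := hαD hD
    have e₁ : ℓ * s * α ^ 2 + (α ^ 2 + 2 * (ℓ + s) * α + ℓ * s) / n + 3 / ((n : ℝ) * (n + 2)) =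
        (1 - α) * (-(ℓ + s + α * (1 + n * (ℓ * s))) / n) := by
      field_simp
      linear_combination hα'
    have e₂ : -(ℓ + s + α * (1 + n * (ℓ * s))) / n =
        boundDenom n ℓ s / (n * ((n + 2) * (n * ℓ * s + ℓ + s + 1))) := by
      rw [boundDenom, div_eq_div_iff (by positivity) (mul_ne_zero (by positivity)
        (mul_ne_zero (by positivity) hD))]
      linear_combination -(n * (1 + n * (ℓ * s))) * hα'
    rw [hf₀, e₁, e₂, hκ]
    field_simp
  have hmain : (n : ℝ) * ℓ * s + ℓ + s + 1 ≠ 0 ∧ 0 < zerothCoeff n (levPoly n 2 ℓ s) := by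
    rcases hdom with hdom | hdom
    · obtain ⟨hD, hB⟩ := neg_of_inRange n hn hℓ hdom (hα ▸ h1)
      refine ⟨hD.ne, ?_⟩
      rw [hF hD.ne]
      refine mul_pos hκ0 (div_pos_of_neg_of_neg hB ?_)
      exact mul_neg_of_pos_of_neg (by positivity) (mul_neg_of_pos_of_neg (by positivity) hD)
    · exact hdom
  obtain ⟨hD, hpos⟩ := hmain
  refine ⟨fun t => ?_, hpos, maxCard_le_of_forall_card_le fun K hK => ?_, ?_⟩
  · rw [hP, mul_eq_zero, or_iff_right hκ0.ne', sub_eq_zero]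
  · rw [le_div_iff₀ hpos]
    have hκ2 : 0 ≤ κ ^ 2 := sq_nonneg κ
    refine card_mul_le_of_gegenbauer (by omega) hK (f := fun t => (levPoly n 2 ℓ s).eval t)
      (a₁ := κ ^ 2 * -((ℓ + s) * α ^ 2 + 2 * α * (ℓ * s + 3 / ((n : ℝ) + 2))
        + 3 * (ℓ + s) / ((n : ℝ) + 2)))
      (a₂ := κ ^ 2 * (α ^ 2 + 2 * (ℓ + s) * α + ℓ * s + 6 / ((n : ℝ) + 4)))
      (a₃ := κ ^ 2 * -(ℓ + s + 2 * α)) (a₄ := κ ^ 2)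
      (mul_nonneg hκ2 (by linarith)) (mul_nonneg hκ2 h2) (mul_nonneg hκ2 (by linarith)) hκ2
      (fun t => ?_) fun t h₁ h₂ => ?_
    · simp only [hf, hf₀]
      field_simp
      ring
    · simp only [hf]
      exact mul_nonpos_of_nonpos_of_nonneg
        (mul_nonpos_of_nonneg_of_nonpos (by linarith) (by linarith)) (sq_nonneg _)
  · have hB : boundDenom n ℓ s ≠ 0 := by
      intro h0
      rw [hF hD, h0] at hpos
      simp at hpos
    have h1α : (1 - α) * ((n + 2) * (n * ℓ * s + ℓ + s + 1)) =
        3 + (n + 2) * (n * ℓ * s + ℓ * s + 2 * ℓ + 2 * s + 1) := by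
      linear_combination -hαD hD
    have e : (levPoly n 2 ℓ s).eval 1 = (1 - ℓ) * (1 - s) := by
      rw [hf, hκ, inv_mul_cancel₀ hα1.ne']
      ring
    rw [e, hF hD, ← h1α, hκ]
    change _ = _ / boundDenom n ℓ s
    field_simp
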